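/- For $n\ge 0$ let $\mathcal X_{2n}$ be the set of even-odd descent permutations of $[2n]$, i.e. permutations $\sigma=\sigma_1\cdots\sigma_{2n}$ such that $\sigma_i$ is even and $\sigma_{i+1}$ is odd whenever $\sigma_i>\sigma_{i+1}$. For such a descent, $\sigma_i$ is called a descent top and $\sigma_{i+1}$ a descent bottom. For $\sigma\in\mathcal X_{2n}$ let $\mathrm{des}\,\sigma$ be the number of descents; $\mathrm{lema}\,\sigma$, $\mathrm{loma}\,\sigma$ the numbers of even, respectively odd, left-to-right maxima; $\mathrm{remi}\,\sigma$, $\mathrm{romi}\,\sigma$ the numbers of even, respectively odd, right-to-left minima; $\mathrm{les}\,\sigma$ the number of pairs $(i,j)$ with $2\le i<j\le 2n$ and $\sigma_{i-1}>\sigma_j>\sigma_i$; $\mathrm{res}\,\sigma$ the number of pairs $(i,j)$ with $1\le i<j\le 2n-1$ and $\sigma_j>\sigma_i>\sigma_{j+1}$; and $\mathrm{dom}\,\sigma$ the number of $j\in[n]$ such that $2j$ is a descent top and $2j-1$ is a descent bottom of $\sigma$. Put $$X_n(a,\bar a,b,\bar b,p,q,y,t)=\sum_{\sigma\in\mathcal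 X_{2n}}a^{\mathrm{lema}\,\sigma}\bar a^{\mathrm{loma}\,\sigma}b^{\mathrm{romi}\,\sigma}\bar b^{\mathrm{remi}\,\sigma}p^{\mathrm{res}\,\sigma}q^{\mathrm{les}\,\sigma}y^{\mathrm{dom}\,\sigma}t^{\mathrm{des}\,\sigma}.$$ An even-odd descent permutation $\sigma$ is an $\mathcal E$-permutation if for no $j\in[n]$ the entries $2j-1$ and $2j$ are simultaneously a descent bottom and a descent top of $\sigma$; let $\overline{\mathcal X}_{2n,k}$ be the set of $\mathcal E$-permutations in $\mathcal X_{2n}$ with exactly $k$ descents. For $n\ge1$ let $$[x,n]_{p,q}=xp^{n-1}+\sum_{i=1}^{n-1}p^{n-1-i}q^i .$$ **Theorem.** As formal power series in $x$, $$1+\sum_{n\ge1}X_n(a,1,b,1,p,q,y,t)\,x^n=\cfrac{1}{1-b_0x-\cfrac{\lambda_1x^2}{1-b_1x-\cfrac{\lambda_2x^2}{1-b_2x-\cdots}}}$$ with, for $n\ge1$, $$b_{n-1}=(1+ty)\,[a,n]_{p,q}\,[b,n]_{q,p},\qquad \lambda_n=t\,[a,n]_{p,q}\,[a,n+1]_{p,q}\,[b,n]_{q,p}\,[b,n+1]_{q,p}.$$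 Moreover, for all $n\ge0$, $$X_n(a,1,b,1,p,q,y,t)=\sum_{k=0}^{\lfloor n/2\rfloor}\gamma_{n,k}(a,b,p,q)\,t^k(1+yt)^{n-2k},$$ where $$\gamma_{n,k}(a,b,p,q)=\sum_{\sigma\in\overline{\mathcal X}_{2n,k}}a^{\mathrm{lema}\,\sigma}b^{\mathrm{romi}\,\sigma}p^{\mathrm{res}\,\sigma}q^{\mathrm{les}\,\sigma}.$$ -/

import Mathlib

/-! Even-odd descent permutations of `[2n]`, their statistics, and formal J-fractions.

A permutation `σ` of `[m] = {1, …, m}` is an element of `Equiv.Perm (Fin m)`, read as the word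
`σ₁ σ₂ … σₘ`; positions and letters are both shifted by one, see `letter`. -/

namespace EvenOdd

open Finset PowerSeries

section Words

variable {m : ℕ}

/-- The letter, an element of `{1, …, m}`, of the word of `σ` at position `i`. -/
def letter (σ : Equiv.Perm (Fin m)) (i : Fin m) : ℕ := (σ i : ℕ) + 1

/-- `i`, `j` are consecutive positions (in this order) and `(σᵢ, σⱼ)` is a descent of `σ`. -/
def IsDescent (σ : Equiv.Perm (Fin m)) (i j : Fin m) : Prop :=
  (i : ℕ) + 1 = j ∧ letter σ j < letter σ i

instance (σ : Equiv.Perm (Fin m)) (i j : Fin m) : Decidable (IsDescent σ i j) := by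
  unfold IsDescent; infer_instance

/-- The number of descents. -/
def des (σ : Equiv.Perm (Fin m)) : ℕ :=
  #{x : Fin m × Fin m | IsDescent σ x.1 x.2}

/-- The value `v` is a descent top of `σ`. -/
def IsDescentTop (σ : Equiv.Perm (Fin m)) (v : ℕ) : Prop :=
  ∃ i j, IsDescent σ i j ∧ letter σ i = v

/-- The value `v` is a descent bottom of `σ`. -/
def IsDescentBottom (σ : Equiv.Perm (Fin m)) (v : ℕ) : Prop :=
  ∃ i j, IsDescent σ i j ∧ letter σ j = v

instance (σ : Equiv.Perm (Fin m)) (v : ℕ) : Decidable (IsDescentTop σ v) := by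
  unfold IsDescentTop; infer_instance

instance (σ : Equiv.Perm (Fin m)) (v : ℕ) : Decidable (IsDescentBottom σ v) := by
  unfold IsDescentBottom; infer_instance

/-- The letter at position `i` is a left-to-right maximum. -/
def IsLRMax (σ : Equiv.Perm (Fin m)) (i : Fin m) : Prop :=
  ∀ j, j < i → letter σ j < letter σ i

/-- The letter at position `i` is a right-to-left minimum. -/
def IsRLMin (σ : Equiv.Perm (Fin m)) (i : Fin m) : Prop :=
  ∀ j, i < j → letter σ i < letter σ j

instance (σ : Equiv.Perm (Fin m)) (i : Fin m) : Decidable (IsLRMax σ i) := by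
  unfold IsLRMax; infer_instance

instance (σ : Equiv.Perm (Fin m)) (i : Fin m) : Decidable (IsRLMin σ i) := by
  unfold IsRLMin; infer_instance

/-- The number of even left-to-right maxima. -/
def lema (σ : Equiv.Perm (Fin m)) : ℕ := #{i | IsLRMax σ i ∧ Even (letter σ i)}

/-- The number of odd left-to-right maxima. -/
def loma (σ : Equiv.Perm (Fin m)) : ℕ := #{i | IsLRMax σ i ∧ Odd (letter σ i)}

/-- The number of even right-to-left minima. -/
def remi (σ : Equiv.Perm (Fin m)) : ℕ := #{i | IsRLMin σ i ∧ Even (letter σ i)}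

/-- The number of odd right-to-left minima. -/
def romi (σ : Equiv.Perm (Fin m)) : ℕ := #{i | IsRLMin σ i ∧ Odd (letter σ i)}

/-- The number of pairs `(i, j)` with `2 ≤ i < j ≤ m` and `σᵢ₋₁ > σⱼ > σᵢ`
(`h` is the position `i - 1`). -/
def les (σ : Equiv.Perm (Fin m)) : ℕ :=
  #{x : Fin m × Fin m | x.1 < x.2 ∧
    ∃ h : Fin m, (h : ℕ) + 1 = x.1 ∧ letter σ x.2 < letter σ h ∧ letter σ x.1 < letter σ x.2}

/-- The number of pairs `(i, j)` with `1 ≤ i < j ≤ m - 1` and `σⱼ > σᵢ > σⱼ₊₁`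
(`h` is the position `j + 1`). -/
def res (σ : Equiv.Perm (Fin m)) : ℕ :=
  #{x : Fin m × Fin m | x.1 < x.2 ∧
    ∃ h : Fin m, (x.2 : ℕ) + 1 = h ∧ letter σ x.1 < letter σ x.2 ∧ letter σ h < letter σ x.1}

/-- The number of dominos of `σ`: the `j ∈ [n]` such that `2j` is a descent top and `2j - 1` is a
descent bottom. -/
def dom {n : ℕ} (σ : Equiv.Perm (Fin (2 * n))) : ℕ :=
  #{j ∈ Icc 1 n | IsDescentTop σ (2 * j) ∧ IsDescentBottom σ (2 * j - 1)}

end Words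

/-- The even-odd descent permutations of `[2n]`: every descent has an even top and an odd bottom. -/
def evenOddPerms (n : ℕ) : Finset (Equiv.Perm (Fin (2 * n))) :=
  {σ | ∀ i j, IsDescent σ i j → Even (letter σ i) ∧ Odd (letter σ j)}

/-- The `𝓔`-permutations of `[2n]`: the even-odd descent permutations such that for no `j ∈ [n]`
the entries `2j - 1` and `2j` are simultaneously a descent bottom and a descent top. -/
def ePerms (n : ℕ) : Finset (Equiv.Perm (Fin (2 * n))) :=
  {σ ∈ evenOddPerms n |
    ∀ j ∈ Icc 1 n, ¬ (IsDescentBottom σ (2 * j - 1) ∧ IsDescentTop σ (2 * j))}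

section Polynomials

variable {R : Type*} [CommRing R]

/-- The eight-variable generating polynomial `Xₙ(a, a', b, b', p, q, y, t)` of the even-odd descent
permutations of `[2n]` (`a'`, `b'` stand for the barred letters). -/
def genPoly (n : ℕ) (a a' b b' p q y t : R) : R :=
  ∑ σ ∈ evenOddPerms n, a ^ lema σ * a' ^ loma σ * b ^ romi σ * b' ^ remi σ *
    p ^ res σ * q ^ les σ * y ^ dom σ * t ^ des σ

/-- `γ_{n,k}(a, b, p, q)`: the generating polynomial of the `𝓔`-permutations of `[2n]` with exactly
`k` descents. -/
def gammaCoeff (n k : ℕ) (a b p q : R) : R :=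
  ∑ σ ∈ ePerms n with des σ = k, a ^ lema σ * b ^ romi σ * p ^ res σ * q ^ les σ

/-- The generalized `(p, q)`-integer
`[x, n]_{p,q} = x pⁿ⁻¹ + ∑_{i=1}^{n-1} pⁿ⁻¹⁻ⁱ qⁱ`, for `n ≥ 1`. -/
def pqInt (x : R) (n : ℕ) (p q : R) : R :=
  x * p ^ (n - 1) + ∑ i ∈ Icc 1 (n - 1), p ^ (n - 1 - i) * q ^ i

/-- The finite continued fraction with `h` rows
`1/(1 - βₖ x - λₖ₊₁ x²/(1 - βₖ₊₁ x - ⋯ - λₖ₊ₕ₋₁ x²/(1 - βₖ₊ₕ₋₁ x)))`, a formal power series. All the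
denominators have constant term `1`, so that `invOfUnit _ 1` is the inverse. -/
noncomputable def jConvergent (β lam : ℕ → R) : ℕ → ℕ → R⟦X⟧
  | 0, _ => 0
  | h + 1, k => invOfUnit
      (1 - C (β k) * X - C (lam (k + 1)) * X ^ 2 * jConvergent β lam h (k + 1)) 1

theorem jConvergent_spec (β lam : ℕ → R) (h k : ℕ) :
    (1 - C (β k) * X - C (lam (k + 1)) * X ^ 2 * jConvergent β lam h (k + 1)) *
      jConvergent β lam (h + 1) k = 1 := by
  rw [jConvergent]
  exact mul_invOfUnit _ 1 (by simp)

/-- The formal power series `F` is the infinite J-fraction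
`1/(1 - β₀ x - λ₁ x²/(1 - β₁ x - λ₂ x²/(1 - β₂ x - ⋯)))`: the finite truncations converge to `F`
coefficientwise, every coefficient being eventually constant. The value `lam 0` plays no role. -/
def HasJFraction (F : R⟦X⟧) (β lam : ℕ → R) : Prop :=
  ∀ n : ℕ, ∀ᶠ h in Filter.atTop, coeff n (jConvergent β lam h 0) = coeff n F

end Polynomials

end EvenOdd

/-!
Following Françon and Viennot, a permutation is encoded by recording, for each letter `v`, whether
`v` is a descent bottom, whether it is a descent top, and how many descents from a letter above `v`
to a letter below `v` lie to the left, respectively to the right, of `v`. The number of descents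
crossing the gap between `v - 1` and `v` is the height from which the step of `v` starts, so that
the steps of successive letters form a path from height `0` to height `0`. For `u < v`, the letter
`u` precedes `v` if and only if at most as many descents cross the gap below `v` to the left of `u`
as to the left of `v`, and the former number depends only on the steps of the letters below `v`; so
the encoding is injective. It is onto, since there are as many such step sequences of length `m` as
permutations, namely `m!`.

The statistics are read off from the single steps: `les` and `res` are the sums of the left and
right counts, and a letter is a left-to-right maximum (right-to-left minimum) exactly when its left
(right) count is `0` and it is not a descent bottom (top). In an even-odd descent permutation the
letters `2j - 1` and `2j` never lower, respectively raise, the height, so together they make one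
step of a Motzkin path. A level step arises in two ways, without descent bottom and top, or from a
domino, whence the factor `1 + t y`. The J-fraction is then Flajolet's. The `γ`-expansion sorts the
paths by their number `k` of down steps, a path of length `n` having `n - 2k` level steps; setting
`y = 0` identifies its coefficients.
-/

namespace EvenOdd

open Finset PowerSeries

/-- A step of a history. The step of a letter `v` of a word records whether `v` is a descent bottom
and a descent top, and how many descents `x > v > y` lie to the left and to the right of `v`. -/
structure Step where
  isBottom : Bool
  isTop : Bool
  left : ℕ
  right : ℕ
deriving DecidableEq

namespace Step

/-- The height at which a step starts: the number of descents `x ≥ v > y`. -/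
def source (s : Step) : ℕ := s.left + s.right + s.isTop.toNat

/-- The height at which a step ends: the number of descents `x > v ≥ y`. -/
def target (s : Step) : ℕ := s.left + s.right + s.isBottom.toNat

end Step

section Words

variable (τ : Equiv.Perm ℕ)

/-- The letter `v` of the word `τ 0, τ 1, …` is followed by a smaller one. -/
def IsTopLetter (v : ℕ) : Prop := τ (τ.symm v + 1) < v

/-- The letter `v` of the word `τ 0, τ 1, …` is preceded by a larger one. -/
def IsBottomLetter (v : ℕ) : Prop := 0 < τ.symm v ∧ v < τ (τ.symm v - 1)

instance (v : ℕ) : Decidable (IsTopLetter τ v) := by unfold IsTopLetter; infer_instance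

instance (v : ℕ) : Decidable (IsBottomLetter τ v) := by unfold IsBottomLetter; infer_instance

/-- The number of positions in `[k, l)` at which the word `τ 0, τ 1, …` descends from a letter `≥ v`
to a letter `< v`. -/
def falls (v k l : ℕ) : ℕ := #{i ∈ Ico k l | τ (i + 1) < v ∧ v ≤ τ i}

/-- The number of positions in `[k, l)` at which the word `τ 0, τ 1, …` descends from a letter `> v`
to a letter `< v`. -/
def crossings (v k l : ℕ) : ℕ := #{i ∈ Ico k l | τ (i + 1) < v ∧ v < τ i}

/-- The step of the letter `v` in the word `τ 0, …, τ (m - 1)`. -/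
def stepAt (m v : ℕ) : Step where
  isBottom := IsBottomLetter τ v
  isTop := IsTopLetter τ v
  left := crossings τ v 0 (τ.symm v)
  right := crossings τ v (τ.symm v) m

theorem falls_add_falls {v k l r : ℕ} (hkl : k ≤ l) (hlr : l ≤ r) :
    falls τ v k l + falls τ v l r = falls τ v k r := by
  simp only [falls, card_filter]
  exact sum_Ico_consecutive _ hkl hlr

theorem crossings_add_crossings {v k l r : ℕ} (hkl : k ≤ l) (hlr : l ≤ r) :
    crossings τ v k l + crossings τ v l r = crossings τ v k r := by
  simp only [crossings, card_filter]
  exact sum_Ico_consecutive _ hkl hlr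

theorem falls_eq_crossings_add (v k l : ℕ) : falls τ v k l =
    crossings τ v k l + if τ.symm v ∈ Ico k l ∧ IsTopLetter τ v then 1 else 0 := by
  have hpoint (i : ℕ) : (if τ (i + 1) < v ∧ v ≤ τ i then 1 else 0) =
      (if τ (i + 1) < v ∧ v < τ i then 1 else 0) +
        if τ.symm v = i then if IsTopLetter τ v then 1 else 0 else 0 := by
    by_cases hi : τ.symm v = i
    · subst hi; simp [IsTopLetter]
    · have : τ i ≠ v := fun h => hi (by simp [← h])
      simp [hi, le_iff_lt_or_eq, this.symm]
  simp only [falls, crossings, card_filter, hpoint, sum_add_distrib, sum_ite_eq, ite_and]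

theorem falls_succ_eq_crossings_add (v k l : ℕ) : falls τ (v + 1) k l =
    crossings τ v k l + if τ.symm v ∈ Ioc k l ∧ IsBottomLetter τ v then 1 else 0 := by
  have hpoint (i : ℕ) : (if τ (i + 1) < v + 1 ∧ v + 1 ≤ τ i then 1 else 0) =
      (if τ (i + 1) < v ∧ v < τ i then 1 else 0) +
        if i + 1 = τ.symm v ∧ IsBottomLetter τ v then 1 else 0 := by
    by_cases hi : i + 1 = τ.symm v
    · simp [IsBottomLetter, ← hi, ((Equiv.eq_symm_apply τ).1 hi)]
    · have : τ (i + 1) ≠ v := fun h => hi (by simp [← h])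
      simp [hi, Order.lt_add_one_iff, this.le_iff_lt]
  simp only [falls, crossings, card_filter, hpoint, sum_add_distrib, add_right_inj]
  split_ifs with h
  · obtain ⟨i, hi⟩ : ∃ i, τ.symm v = i + 1 := ⟨τ.symm v - 1, by have := h.2.1; omega⟩
    rw [hi, mem_Ioc] at h
    simp only [hi, add_left_inj, h.2, and_true, sum_ite_eq', mem_Ico]
    exact if_pos (by omega)
  · refine sum_eq_zero fun i hi => if_neg fun hi' => h ⟨?_, hi'.2⟩
    rw [mem_Ico] at hi
    rw [mem_Ioc]
    omega

theorem exists_mem_Ico_and_not_succ {P : ℕ → Prop} {k l : ℕ} (hkl : k ≤ l) (hk : P k)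
    (hl : ¬ P l) : ∃ i ∈ Ico k l, P i ∧ ¬ P (i + 1) := by
  by_contra! h
  have hP : ∀ i, k ≤ i → i ≤ l → P i := Nat.le_induction (fun _ => hk) fun i hki ih hil =>
    h i (mem_Ico.2 ⟨hki, hil⟩) (ih (by omega))
  exact hl (hP l hkl le_rfl)

theorem falls_pos_iff_exists {v k l : ℕ} (hl : τ l < v) :
    0 < falls τ v k l ↔ ∃ i ∈ Ico k l, v ≤ τ i := by
  rw [falls, card_pos]
  constructor
  · rintro ⟨i, hi⟩
    rw [mem_filter] at hi
    exact ⟨i, hi.1, hi.2.2⟩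
  · rintro ⟨i, hi, hvi⟩
    rw [mem_Ico] at hi
    obtain ⟨j, hj, hvj, hvj'⟩ := exists_mem_Ico_and_not_succ (P := (v ≤ τ ·)) hi.2.le hvi hl.not_ge
    rw [mem_Ico] at hj
    exact ⟨j, by rw [mem_filter, mem_Ico]; omega⟩

theorem falls_pos_iff_exists_lt {v k l : ℕ} (hk : v ≤ τ k) :
    0 < falls τ v k l ↔ ∃ i ∈ Ioc k l, τ i < v := by
  rw [falls, card_pos]
  constructor
  · rintro ⟨i, hi⟩
    rw [mem_filter, mem_Ico] at hi
    exact ⟨i + 1, mem_Ioc.2 (by omega), hi.2.1⟩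
  · rintro ⟨i, hi, hvi⟩
    rw [mem_Ioc] at hi
    obtain ⟨j, hj, hvj, hvj'⟩ := exists_mem_Ico_and_not_succ (P := (v ≤ τ ·)) hi.1.le hk hvi.not_ge
    rw [mem_Ico] at hj
    exact ⟨j, by rw [mem_filter, mem_Ico]; omega⟩

theorem falls_zero (k l : ℕ) : falls τ 0 k l = 0 := by
  simp [falls]

theorem crossings_zero_symm_apply (v : ℕ) :
    crossings τ v 0 (τ.symm v) = falls τ v 0 (τ.symm v) := by
  simp [falls_eq_crossings_add]

theorem falls_succ_zero_symm_apply (m v : ℕ) : falls τ (v + 1) 0 (τ.symm v) =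
    (stepAt τ m v).left + (stepAt τ m v).isBottom.toNat := by
  have hpos : IsBottomLetter τ v → 0 < τ.symm v := And.left
  simp [falls_succ_eq_crossings_add, stepAt, Bool.toNat, Bool.cond_decide,
    and_iff_right_of_imp hpos]

theorem falls_symm_apply {m v : ℕ} (hv : τ.symm v < m) : falls τ v (τ.symm v) m =
    (stepAt τ m v).right + (stepAt τ m v).isTop.toNat := by
  simp [falls_eq_crossings_add, stepAt, hv, Bool.toNat, Bool.cond_decide]

theorem source_stepAt {m v : ℕ} (hv : τ.symm v < m) : (stepAt τ m v).source = falls τ v 0 m := by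
  simp [Step.source, stepAt, crossings_add_crossings _ (Nat.zero_le _) hv.le, hv,
    falls_eq_crossings_add, Bool.toNat, Bool.cond_decide]

theorem target_stepAt {m v : ℕ} (hv : τ.symm v < m) :
    (stepAt τ m v).target = falls τ (v + 1) 0 m := by
  have hpos : IsBottomLetter τ v → 0 < τ.symm v := And.left
  simp [Step.target, stepAt, crossings_add_crossings _ (Nat.zero_le _) hv.le, hv.le,
    falls_succ_eq_crossings_add, Bool.toNat, Bool.cond_decide, and_iff_right_of_imp hpos]

theorem left_eq_zero_and_not_isBottom_iff (m v : ℕ) :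
    (stepAt τ m v).left = 0 ∧ (stepAt τ m v).isBottom = false ↔ ∀ i < τ.symm v, τ i < v := by
  have hlt (i : ℕ) : i < τ.symm v → (τ i < v ↔ τ i ≤ v) := fun hi =>
    (Ne.le_iff_lt fun h => hi.ne (by simp [← h])).symm
  have h := falls_pos_iff_exists τ (v := v + 1) (k := 0) (l := τ.symm v) (by simp)
  simpa +contextual [falls_succ_zero_symm_apply τ m, Nat.pos_iff_ne_zero, hlt] using not_congr h

theorem right_eq_zero_and_not_isTop_iff {m v : ℕ} (hv : τ.symm v < m) (hm : v < τ m) :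
    (stepAt τ m v).right = 0 ∧ (stepAt τ m v).isTop = false ↔
      ∀ i, τ.symm v < i → i < m → v < τ i := by
  have hlt (i : ℕ) : τ.symm v < i → (v < τ i ↔ v ≤ τ i) := fun hi =>
    (Ne.le_iff_lt fun h => hi.ne (by simp [h])).symm
  have h := falls_pos_iff_exists_lt τ (v := v) (k := τ.symm v) (l := m) (by simp)
  rw [falls_symm_apply τ hv, ← not_iff_not] at h
  simp only [add_pos_iff, Nat.pos_iff_ne_zero, Bool.toNat_eq_zero, not_or, not_not, ne_eq, mem_Ioc,
    not_exists, not_and, not_lt, and_imp] at h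
  refine h.trans (forall₂_congr fun i hi => ?_)
  rw [hlt i hi]
  exact ⟨fun H him => H him.le, fun H him => him.lt_or_eq.elim H fun hi => hi ▸ hm.le⟩

theorem symm_lt_symm_iff {u v : ℕ} (huv : u < v) :
    τ.symm u < τ.symm v ↔ falls τ v 0 (τ.symm u) ≤ crossings τ v 0 (τ.symm v) := by
  rw [crossings_zero_symm_apply]
  constructor <;> intro h
  · rw [← falls_add_falls τ (Nat.zero_le _) h.le]
    exact Nat.le_add_right _ _
  · by_contra! hvu
    have hne : τ.symm v ≠ τ.symm u := fun h => huv.ne' (τ.symm.injective h)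
    have hpos : 0 < falls τ v (τ.symm v) (τ.symm u) :=
      (falls_pos_iff_exists τ (by simpa)).2 ⟨τ.symm v, by rw [mem_Ico]; omega, by simp⟩
    rw [← falls_add_falls τ (Nat.zero_le _) hvu] at h
    omega

end Words

theorem falls_zero_symm_apply_eq_of_stepAt_eq {τ τ' : Equiv.Perm ℕ} {m v : ℕ}
    (h : ∀ w < v, stepAt τ m w = stepAt τ' m w) {u : ℕ} (hu : u < v) :
    falls τ v 0 (τ.symm u) = falls τ' v 0 (τ'.symm u) := by
  induction v generalizing u with
  | zero => simp at hu
  | succ v ih =>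
    rcases Nat.lt_succ_iff_lt_or_eq.1 hu with huv | rfl
    · have ih := ih (fun w hw => h w (by omega)) huv
      have hstep := h v (by omega)
      simp only [stepAt, Step.mk.injEq, decide_eq_decide] at hstep
      have horder : τ.symm u < τ.symm v ↔ τ'.symm u < τ'.symm v := by
        rw [symm_lt_symm_iff τ huv, symm_lt_symm_iff τ' huv, ih, hstep.2.2.1]
      have hne : τ.symm u ≠ τ.symm v := τ.symm.injective.ne huv.ne
      have hne' : τ'.symm u ≠ τ'.symm v := τ'.symm.injective.ne huv.ne
      have hIco : τ.symm v ∈ Ico 0 (τ.symm u) ↔ τ'.symm v ∈ Ico 0 (τ'.symm u) := by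
        simp only [mem_Ico]; omega
      have hIoc : τ.symm v ∈ Ioc 0 (τ.symm u) ∧ IsBottomLetter τ v ↔
          τ'.symm v ∈ Ioc 0 (τ'.symm u) ∧ IsBottomLetter τ' v := by
        have hpos : IsBottomLetter τ v → 0 < τ.symm v := And.left
        have hpos' : IsBottomLetter τ' v → 0 < τ'.symm v := And.left
        simp only [mem_Ioc]
        grind
      simp only [falls_eq_crossings_add, hIco, hstep.2.1] at ih
      simp only [falls_succ_eq_crossings_add, hIoc]
      omega
    · rw [falls_succ_zero_symm_apply τ m, falls_succ_zero_symm_apply τ' m, h u hu]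

/-- The sequence of the steps of the letters `0, …, m - 1`. -/
def history (τ : Equiv.Perm ℕ) (m : ℕ) : List Step := (List.range m).map (stepAt τ m)

theorem symm_lt_symm_iff_of_history_eq {τ τ' : Equiv.Perm ℕ} {m : ℕ}
    (h : history τ m = history τ' m) {u v : ℕ} (hu : u < m) (hv : v < m) :
    τ.symm u < τ.symm v ↔ τ'.symm u < τ'.symm v := by
  have hstep : ∀ w < m, stepAt τ m w = stepAt τ' m w := by
    simpa [history, List.map_inj_left] using h
  have hlt {u v : ℕ} (huv : u < v) (hv : v < m) :
      τ.symm u < τ.symm v ↔ τ'.symm u < τ'.symm v := by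
    rw [symm_lt_symm_iff τ huv, symm_lt_symm_iff τ' huv,
      falls_zero_symm_apply_eq_of_stepAt_eq (fun w hw => hstep w (hw.trans hv)) huv]
    exact iff_of_eq (congrArg (_ ≤ ·) (congrArg Step.left (hstep v hv)))
  rcases lt_trichotomy u v with huv | rfl | huv
  · exact hlt huv hv
  · simp
  · have := hlt huv hu
    have hne : τ.symm u ≠ τ.symm v := τ.symm.injective.ne huv.ne'
    have hne' : τ'.symm u ≠ τ'.symm v := τ'.symm.injective.ne huv.ne'
    omega

section Extend

variable {m : ℕ} (σ : Equiv.Perm (Fin m))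

/-- The word of `σ` followed by the letters `m, m + 1, …`, which add no descents. Its letters are
numbered from `0`: the letter `v` is the `letter` of value `v + 1`, of the opposite parity. -/
def extend : Equiv.Perm ℕ := σ.extendDomain Fin.equivSubtype

@[simp]
theorem extend_coe (i : Fin m) : extend σ i = σ i :=
  σ.extendDomain_apply_image Fin.equivSubtype i

theorem extend_of_lt {i : ℕ} (hi : i < m) : extend σ i = σ ⟨i, hi⟩ :=
  extend_coe σ ⟨i, hi⟩

@[simp]
theorem extend_of_le {i : ℕ} (hi : m ≤ i) : extend σ i = i :=
  σ.extendDomain_apply_not_subtype Fin.equivSubtype hi.not_gt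

@[simp]
theorem extend_symm_coe (v : Fin m) : (extend σ).symm v = σ.symm v := by
  simp [Equiv.symm_apply_eq]

theorem extend_symm_lt {v : ℕ} (hv : v < m) : (extend σ).symm v < m :=
  extend_symm_coe σ ⟨v, hv⟩ ▸ (σ.symm ⟨v, hv⟩).isLt

end Extend

theorem history_extend_injective (m : ℕ) :
    Function.Injective fun σ : Equiv.Perm (Fin m) => history (extend σ) m := by
  intro σ σ' h
  have hlt (u v : Fin m) : σ.symm u < σ.symm v ↔ σ'.symm u < σ'.symm v := by
    simpa using symm_lt_symm_iff_of_history_eq h u.isLt v.isLt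
  let e : Fin m ≃o Fin m := ⟨σ.trans σ'.symm, fun {i j} => by
    simpa using (not_congr (hlt (σ j) (σ i))).symm⟩
  have he : e = OrderIso.refl _ := Subsingleton.elim _ _
  ext i
  have hi : σ'.symm (σ i) = i := congrArg (· i) he
  rw [(Equiv.symm_apply_eq _).1 hi]

/-- The steps starting at height `k`. -/
def stepsFrom (k : ℕ) : Finset Step :=
  (univ ×ˢ antidiagonal k).image (fun x => ⟨x.1, false, x.2.1, x.2.2⟩) ∪
    match k with
    | 0 => ∅
    | k + 1 => (univ ×ˢ antidiagonal k).image (fun x => ⟨x.1, true, x.2.1, x.2.2⟩)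

theorem mem_stepsFrom {k : ℕ} {s : Step} : s ∈ stepsFrom k ↔ s.source = k := by
  obtain ⟨bottom, top, left, right⟩ := s
  cases top <;> cases k <;> cases bottom <;> simp [stepsFrom, Step.source]

section Sums

variable {M : Type*} [AddCommMonoid M]

theorem sum_image_step (k : ℕ) (top : Bool) (f : Step → M) :
    ∑ s ∈ (univ ×ˢ antidiagonal k).image (fun x : Bool × ℕ × ℕ => ⟨x.1, top, x.2.1, x.2.2⟩), f s =
      ∑ x ∈ antidiagonal k, (f ⟨false, top, x.1, x.2⟩ + f ⟨true, top, x.1, x.2⟩) := by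
  rw [sum_image fun x _ y _ h => by aesop, sum_product_right]
  simp [add_comm]

theorem sum_stepsFrom_zero (f : Step → M) :
    ∑ s ∈ stepsFrom 0, f s =
      ∑ x ∈ antidiagonal 0, (f ⟨false, false, x.1, x.2⟩ + f ⟨true, false, x.1, x.2⟩) := by
  rw [stepsFrom, union_empty, sum_image_step]

theorem sum_stepsFrom_succ (k : ℕ) (f : Step → M) : ∑ s ∈ stepsFrom (k + 1), f s =
    ∑ x ∈ antidiagonal (k + 1), (f ⟨false, false, x.1, x.2⟩ + f ⟨true, false, x.1, x.2⟩) +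
      ∑ x ∈ antidiagonal k, (f ⟨false, true, x.1, x.2⟩ + f ⟨true, true, x.1, x.2⟩) := by
  rw [stepsFrom, sum_union, sum_image_step, sum_image_step]
  simp only [disjoint_left, mem_image]
  aesop

end Sums

/-- The histories of length `n` from height `k` to height `0`. -/
def histories : ℕ → ℕ → Finset (List Step)
  | 0, k => if k = 0 then {[]} else ∅
  | n + 1, k => (stepsFrom k).biUnion fun s => (histories n s.target).image (s :: ·)

theorem sum_histories_succ {M : Type*} [AddCommMonoid M] (n k : ℕ) (f : List Step → M) :
    ∑ H ∈ histories (n + 1) k, f H =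
      ∑ s ∈ stepsFrom k, ∑ H ∈ histories n s.target, f (s :: H) := by
  rw [histories, sum_biUnion]
  · exact sum_congr rfl fun s _ => sum_image fun _ _ _ _ h => (List.cons.inj h).2
  · intro s _ s' _ hne
    simp only [Function.onFun, disjoint_left, mem_image]
    aesop

theorem card_histories (n k : ℕ) : #(histories n k) = n.factorial * n.choose k := by
  induction n generalizing k with
  | zero => cases k <;> simp [histories]
  | succ n ih =>
    have hsum (k : ℕ) (top : Bool) : ∑ x ∈ antidiagonal k,
        (#(histories n (Step.mk false top x.1 x.2).target) +
          #(histories n (Step.mk true top x.1 x.2).target)) =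
        (n + 1).factorial * n.choose k := by
      have hx : ∀ x ∈ antidiagonal k, #(histories n (Step.mk false top x.1 x.2).target) +
          #(histories n (Step.mk true top x.1 x.2).target) =
          n.factorial * (n + 1).choose (k + 1) := fun x hx => by
        simp [Step.target, mem_antidiagonal.1 hx, ih, Nat.choose_succ_succ', mul_add]
      rw [sum_congr rfl hx, sum_const, Nat.card_antidiagonal, smul_eq_mul, Nat.factorial_succ]
      rw [mul_left_comm, mul_comm (k + 1), ← Nat.add_one_mul_choose_eq]
      ring
    have hcard := sum_histories_succ n k fun _ => 1
    simp only [← card_eq_sum_ones] at hcard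
    rw [hcard]
    cases k with
    | zero => rw [sum_stepsFrom_zero, hsum, Nat.choose_zero_right, Nat.choose_zero_right]
    | succ k => rw [sum_stepsFrom_succ, hsum, hsum, Nat.choose_succ_succ' n k, mul_add, add_comm]

theorem map_range'_mem_histories {f : ℕ → Step} {D : ℕ → ℕ} {s n : ℕ}
    (hf : ∀ v, s ≤ v → v < s + n → (f v).source = D v ∧ (f v).target = D (v + 1))
    (hD : D (s + n) = 0) : (List.range' s n).map f ∈ histories n (D s) := by
  induction n generalizing s with
  | zero => simp [histories, show D s = 0 from hD]
  | succ n ih =>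
    have hs := hf s le_rfl (by omega)
    have := ih (s := s + 1) (fun v h1 h2 => hf v (by omega) (by omega)) (by rwa [add_right_comm])
    simp only [List.range'_succ, List.map_cons, histories, mem_biUnion, mem_stepsFrom, mem_image]
    exact ⟨f s, hs.1, _, hs.2.symm ▸ this, rfl⟩

theorem history_extend_mem_histories {m : ℕ} (σ : Equiv.Perm (Fin m)) :
    history (extend σ) m ∈ histories m 0 := by
  have hm : falls (extend σ) m 0 m = 0 := by
    simp only [falls, card_eq_zero, filter_eq_empty_iff, mem_Ico, not_and, not_le]
    intro i hi _
    exact extend_coe σ ⟨i, hi.2⟩ ▸ (σ ⟨i, hi.2⟩).isLt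
  rw [history, List.range_eq_range']
  have := map_range'_mem_histories (f := stepAt (extend σ) m) (s := 0) (n := m)
    (D := fun v => falls (extend σ) v 0 m) (fun v _ hv => ?_) (by simpa)
  · simpa only [falls_zero] using this
  · have := extend_symm_lt σ (v := v) (by simpa using hv)
    exact ⟨source_stepAt _ this, target_stepAt _ this⟩

theorem sum_perm_eq_sum_histories {M : Type*} [AddCommMonoid M] (m : ℕ) (f : List Step → M) :
    ∑ σ : Equiv.Perm (Fin m), f (history (extend σ) m) = ∑ H ∈ histories m 0, f H := by
  have himage : univ.image (fun σ : Equiv.Perm (Fin m) => history (extend σ) m) =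
      histories m 0 := by
    refine eq_of_subset_of_card_le (image_subset_iff.2 fun σ _ => history_extend_mem_histories σ) ?_
    rw [card_image_of_injective _ (history_extend_injective m), card_histories]
    simp [Fintype.card_perm]
  rw [← himage, sum_image fun _ _ _ _ h => history_extend_injective m h]

section Statistics

variable {m : ℕ} (σ : Equiv.Perm (Fin m))

theorem sum_range_extend {M : Type*} [AddCommMonoid M] (f : ℕ → M) :
    ∑ v ∈ range m, f v = ∑ i : Fin m, f (σ i) := by
  rw [← Fin.sum_univ_eq_sum_range, Equiv.sum_comp σ (fun v => f v)]

theorem isDescent_iff {i j : Fin m} : IsDescent σ i j ↔ (i : ℕ) + 1 = j ∧ σ j < σ i := by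
  simp [IsDescent, letter]

theorem lt_of_extend_lt {l : ℕ} (h : extend σ l < m) : l < m := by
  by_contra! hl
  exact hl.not_gt (extend_of_le σ hl ▸ h)

theorem isTopLetter_extend_iff (i : Fin m) :
    IsTopLetter (extend σ) (σ i) ↔ ∃ j, IsDescent σ i j := by
  simp only [IsTopLetter, extend_symm_coe, Equiv.symm_apply_apply, isDescent_iff]
  constructor
  · intro h
    have hi : (i : ℕ) + 1 < m := lt_of_extend_lt σ (h.trans (σ i).isLt)
    exact ⟨⟨i + 1, hi⟩, rfl, by rwa [extend_of_lt σ hi] at h⟩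
  · rintro ⟨j, hij, h⟩
    rwa [hij, extend_coe]

theorem isBottomLetter_extend_iff (j : Fin m) :
    IsBottomLetter (extend σ) (σ j) ↔ ∃ i, IsDescent σ i j := by
  simp only [IsBottomLetter, extend_symm_coe, Equiv.symm_apply_apply, isDescent_iff]
  constructor
  · rintro ⟨hj, h⟩
    have hj' : (j : ℕ) - 1 < m := by omega
    exact ⟨⟨j - 1, hj'⟩, Nat.succ_pred hj.ne', by rwa [extend_of_lt σ hj'] at h⟩
  · rintro ⟨i, hij, h⟩
    rw [← hij, Nat.add_sub_cancel, extend_coe]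
    exact ⟨Nat.succ_pos _, h⟩

theorem exists_apply_eq {v : ℕ} (hv : v < m) : ∃ i, (σ i : ℕ) = v :=
  ⟨σ.symm ⟨v, hv⟩, by simp⟩

theorem isDescentTop_iff {v : ℕ} (hv : v < m) :
    IsDescentTop σ (v + 1) ↔ IsTopLetter (extend σ) v := by
  obtain ⟨i, rfl⟩ := exists_apply_eq σ hv
  simp [isTopLetter_extend_iff, IsDescentTop, letter, ← Fin.ext_iff]

theorem isDescentBottom_iff {v : ℕ} (hv : v < m) :
    IsDescentBottom σ (v + 1) ↔ IsBottomLetter (extend σ) v := by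
  obtain ⟨j, rfl⟩ := exists_apply_eq σ hv
  simp [isBottomLetter_extend_iff, IsDescentBottom, letter, ← Fin.ext_iff]

theorem isLRMax_iff (i : Fin m) : IsLRMax σ i ↔ (stepAt (extend σ) m (σ i)).left = 0 ∧
    (stepAt (extend σ) m (σ i)).isBottom = false := by
  rw [left_eq_zero_and_not_isBottom_iff, extend_symm_coe, Equiv.symm_apply_apply]
  simp only [IsLRMax, letter, add_lt_add_iff_right]
  exact ⟨fun h j hj => extend_of_lt σ (hj.trans i.isLt) ▸ h ⟨j, hj.trans i.isLt⟩ hj,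
    fun h j hj => by simpa using h j hj⟩

theorem isRLMin_iff (i : Fin m) : IsRLMin σ i ↔ (stepAt (extend σ) m (σ i)).right = 0 ∧
    (stepAt (extend σ) m (σ i)).isTop = false := by
  rw [right_eq_zero_and_not_isTop_iff _ (by simp) (by simp), extend_symm_coe,
    Equiv.symm_apply_apply]
  simp only [IsRLMin, letter, add_lt_add_iff_right]
  exact ⟨fun h j hj hjm => extend_of_lt σ hjm ▸ h ⟨j, hjm⟩ hj,
    fun h j hj => by simpa using h j hj j.isLt⟩

theorem lema_eq_card : lema σ = #{v ∈ range m | Odd v ∧ (stepAt (extend σ) m v).left = 0 ∧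
    (stepAt (extend σ) m v).isBottom = false} := by
  rw [card_filter, sum_range_extend σ, ← card_filter, lema]
  simp [isLRMax_iff, letter, and_comm, parity_simps]

theorem romi_eq_card : romi σ = #{v ∈ range m | Even v ∧ (stepAt (extend σ) m v).right = 0 ∧
    (stepAt (extend σ) m v).isTop = false} := by
  rw [card_filter, sum_range_extend σ, ← card_filter, romi]
  simp [isRLMin_iff, letter, and_comm, parity_simps]

theorem des_eq_card : des σ = #{v ∈ range m | IsTopLetter (extend σ) v} := by
  have hinj : Set.InjOn Prod.fst ((univ.filter fun x : Fin m × Fin m => IsDescent σ x.1 x.2) :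
      Set (Fin m × Fin m)) := by
    simp only [Set.InjOn, coe_filter, Set.mem_ofPred_eq, isDescent_iff]
    rintro ⟨i, j⟩ ⟨-, hij, -⟩ ⟨i', j'⟩ ⟨-, hij', -⟩ rfl
    exact Prod.ext rfl (Fin.ext (hij.symm.trans hij'))
  rw [card_filter, sum_range_extend σ, ← card_filter, des, ← card_image_of_injOn hinj]
  congr 1
  ext i
  simp [isTopLetter_extend_iff]

theorem les_eq_sum : les σ = ∑ v ∈ range m, (stepAt (extend σ) m v).left := by
  rw [sum_range_extend σ, les, card_filter, Fintype.sum_prod_type_right]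
  refine sum_congr rfl fun j _ => ?_
  simp only [← card_filter, stepAt, crossings, extend_symm_coe, Equiv.symm_apply_apply, letter,
    add_lt_add_iff_right]
  refine card_bij (fun i _ => (i : ℕ) - 1) ?_ ?_ ?_ <;>
    simp only [mem_filter, mem_univ, true_and, mem_Ico, Nat.zero_le]
  · rintro i ⟨hij, h, hi, hjh, hlt⟩
    rw [Fin.lt_def] at hij
    rw [← hi, Nat.add_sub_cancel, extend_coe, hi, extend_coe]
    exact ⟨by omega, hlt, hjh⟩
  · rintro i ⟨-, h, hi, -⟩ i' ⟨-, h', hi', -⟩ heq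
    exact Fin.ext (by omega)
  · rintro k ⟨hkj, hlt, hjk⟩
    have hk : k + 1 < m := lt_of_extend_lt σ (hlt.trans (σ j).isLt)
    have hne : k + 1 ≠ j := fun h => by simp [h] at hlt
    rw [extend_of_lt σ hk] at hlt
    rw [extend_of_lt σ (by omega)] at hjk
    exact ⟨⟨k + 1, hk⟩, ⟨Fin.lt_def.2 (lt_of_le_of_ne hkj hne), ⟨k, by omega⟩, rfl, hjk, hlt⟩, rfl⟩

theorem res_eq_sum : res σ = ∑ v ∈ range m, (stepAt (extend σ) m v).right := by
  rw [sum_range_extend σ, res, card_filter, Fintype.sum_prod_type]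
  refine sum_congr rfl fun i _ => ?_
  simp only [← card_filter, stepAt, crossings, extend_symm_coe, Equiv.symm_apply_apply, letter,
    add_lt_add_iff_right]
  refine card_bij (fun j _ => (j : ℕ)) ?_ (fun _ _ _ _ => Fin.ext) ?_ <;>
    simp only [mem_filter, mem_univ, true_and, mem_Ico]
  · rintro j ⟨hij, h, hj, hjh, hlt⟩
    rw [hj, extend_coe, extend_coe]
    exact ⟨⟨hij.le, j.isLt⟩, hlt, hjh⟩
  · rintro k ⟨⟨hik, -⟩, hlt, hjk⟩
    have hk : k + 1 < m := lt_of_extend_lt σ (hlt.trans (σ i).isLt)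
    have hne : (i : ℕ) ≠ k := fun h => by simp [← h] at hjk
    rw [extend_of_lt σ hk] at hlt
    rw [extend_of_lt σ (by omega)] at hjk
    exact ⟨⟨k, by omega⟩, ⟨Fin.lt_def.2 (lt_of_le_of_ne hik hne), ⟨k + 1, hk⟩, rfl, hjk, hlt⟩, rfl⟩

theorem mem_evenOddPerms_iff {n : ℕ} (σ : Equiv.Perm (Fin (2 * n))) : σ ∈ evenOddPerms n ↔
    ∀ v ∈ range (2 * n),
      (IsTopLetter (extend σ) v → Odd v) ∧ (IsBottomLetter (extend σ) v → Even v) := by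
  simp only [evenOddPerms, mem_filter, mem_univ, true_and, mem_range]
  constructor
  · intro h v hv
    obtain ⟨i, rfl⟩ := exists_apply_eq σ hv
    simp only [isTopLetter_extend_iff, isBottomLetter_extend_iff]
    constructor
    · rintro ⟨j, hij⟩
      simpa [letter, parity_simps] using (h i j hij).1
    · rintro ⟨j, hij⟩
      simpa [letter, parity_simps] using (h j i hij).2
  · intro h i j hij
    have htop := (h (σ i) (σ i).isLt).1 ((isTopLetter_extend_iff σ i).2 ⟨j, hij⟩)
    have hbottom := (h (σ j) (σ j).isLt).2 ((isBottomLetter_extend_iff σ j).2 ⟨i, hij⟩)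
    simp [letter, htop, hbottom, parity_simps]

theorem dom_eq_card {n : ℕ} (σ : Equiv.Perm (Fin (2 * n))) : dom σ =
    #{j ∈ range n | IsBottomLetter (extend σ) (2 * j) ∧ IsTopLetter (extend σ) (2 * j + 1)} := by
  rw [dom, card_filter, card_filter, ← Ico_add_one_right_eq_Icc, sum_Ico_eq_sum_range,
    Nat.add_sub_cancel]
  refine sum_congr rfl fun j hj => ?_
  rw [mem_range] at hj
  simp only [show 2 * (1 + j) = 2 * j + 1 + 1 by ring, Nat.add_sub_cancel,
    isDescentTop_iff σ (show 2 * j + 1 < 2 * n by omega),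
    isDescentBottom_iff σ (show 2 * j < 2 * n by omega), and_comm]

end Statistics

section Weights

variable {R : Type*} [CommRing R]

/-- The weight of the step of an odd letter of an even-odd descent permutation: a factor `p` (`q`)
for each descent counted to the right (left), a factor `b` if the letter is a right-to-left minimum,
and `0` if it is a descent top. -/
def oddWeight (b p q : R) (s : Step) : R :=
  if s.isTop then 0 else p ^ s.right * q ^ s.left * if s.right = 0 then b else 1

/-- The weight of the step of an even letter of an even-odd descent permutation: a factor `p` (`q`)
for each descent counted to the right (left), a factor `a` if the letter is a left-to-right maximum,
a factor `t` if it is a descent top, and `0` if it is a descent bottom. -/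
def evenWeight (a p q t : R) (s : Step) : R :=
  if s.isBottom then 0 else
    p ^ s.right * q ^ s.left * (if s.left = 0 then a else 1) * if s.isTop then t else 1

/-- The weight of a history of even length: the product over `j` of the weights of the steps of the
letters `2j - 1` and `2j` and of `y` if these letters form a domino. An unpaired last step would be
ignored. -/
def historyWeight (a b p q y t : R) : List Step → R
  | s₁ :: s₂ :: H => oddWeight b p q s₁ * evenWeight a p q t s₂ *
      (if s₁.isBottom ∧ s₂.isTop then y else 1) * historyWeight a b p q y t H
  | _ => 1

theorem prod_range_two_mul {M : Type*} [CommMonoid M] (f : ℕ → M) (n : ℕ) :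
    ∏ v ∈ range (2 * n), f v = ∏ j ∈ range n, f (2 * j) * f (2 * j + 1) := by
  induction n with
  | zero => simp
  | succ n ih => rw [Nat.mul_succ, prod_range_succ, prod_range_succ, ih, prod_range_succ, mul_assoc]

theorem historyWeight_map_range (a b p q y t : R) (f : ℕ → Step) (n : ℕ) :
    historyWeight a b p q y t ((List.range (2 * n)).map f) =
      ∏ j ∈ range n, oddWeight b p q (f (2 * j)) * evenWeight a p q t (f (2 * j + 1)) *
        if (f (2 * j)).isBottom ∧ (f (2 * j + 1)).isTop then y else 1 := by
  induction n generalizing f with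
  | zero => simp [historyWeight]
  | succ n ih =>
    have hrange : (List.range (2 * (n + 1))).map f =
        f 0 :: f 1 :: (List.range (2 * n)).map fun v => f (v + 2) := by
      simp [Nat.mul_succ, List.range_succ_eq_map, Function.comp_def]
    rw [hrange, historyWeight, ih, prod_range_succ', mul_comm]
    rfl

theorem ite_odd_weight_eq (a b p q t : R) (v : ℕ) (s : Step) :
    (if Odd v then evenWeight a p q t s else oddWeight b p q s) =
      if (s.isTop → Odd v) ∧ (s.isBottom → Even v) then
        (if Odd v ∧ s.left = 0 ∧ s.isBottom = false then a else 1) *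
        (if Even v ∧ s.right = 0 ∧ s.isTop = false then b else 1) *
        p ^ s.right * q ^ s.left * (if s.isTop then t else 1) else 0 := by
  obtain ⟨bottom, top, left, right⟩ := s
  rcases Nat.even_or_odd v with hv | hv
  · have hv' := Nat.not_odd_iff_even.2 hv
    cases top <;> cases bottom <;> simp [oddWeight, hv, hv', mul_assoc, mul_comm]
  · have hv' := Nat.not_even_iff_odd.2 hv
    cases top <;> cases bottom <;> simp [evenWeight, hv, hv', mul_assoc, mul_comm, mul_left_comm]

theorem historyWeight_history (a b p q y t : R) {n : ℕ} (σ : Equiv.Perm (Fin (2 * n))) :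
    historyWeight a b p q y t (history (extend σ) (2 * n)) =
      if σ ∈ evenOddPerms n then a ^ lema σ * 1 ^ loma σ * b ^ romi σ * 1 ^ remi σ *
        p ^ res σ * q ^ les σ * y ^ dom σ * t ^ des σ else 0 := by
  have hparity : ∏ j ∈ range n, oddWeight b p q (stepAt (extend σ) (2 * n) (2 * j)) *
        evenWeight a p q t (stepAt (extend σ) (2 * n) (2 * j + 1)) =
      ∏ v ∈ range (2 * n), if Odd v then evenWeight a p q t (stepAt (extend σ) (2 * n) v) else
        oddWeight b p q (stepAt (extend σ) (2 * n) v) := by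
    simp [prod_range_two_mul, Nat.odd_mul, show ¬ Odd 2 by decide]
  rw [history, historyWeight_map_range, prod_mul_distrib, hparity]
  simp only [ite_odd_weight_eq, prod_ite_zero, prod_mul_distrib, prod_pow_eq_pow_sum, prod_ite,
    prod_const, mem_evenOddPerms_iff, lema_eq_card, romi_eq_card, res_eq_sum, les_eq_sum,
    dom_eq_card, des_eq_card]
  simp [stepAt, mul_right_comm _ (t ^ _)]

theorem genPoly_eq_sum_histories (a b p q y t : R) (n : ℕ) :
    genPoly n a 1 b 1 p q y t = ∑ H ∈ histories (2 * n) 0, historyWeight a b p q y t H := by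
  rw [← sum_perm_eq_sum_histories, genPoly]
  simp only [historyWeight_history, sum_ite_mem, univ_inter]

theorem pqInt_succ_eq_sum_antidiagonal (x p q : R) (k : ℕ) : pqInt x (k + 1) p q =
    ∑ i ∈ antidiagonal k, p ^ i.2 * q ^ i.1 * if i.1 = 0 then x else 1 := by
  rw [Nat.sum_antidiagonal_eq_sum_range_succ_mk, sum_range_succ', pqInt, Nat.add_sub_cancel,
    ← Ico_add_one_right_eq_Icc, sum_Ico_eq_sum_range]
  simp [add_comm, mul_comm]

theorem sum_oddWeight_mul (b p q : R) (k : ℕ) (G : Bool → ℕ → R) :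
    ∑ s ∈ stepsFrom k, oddWeight b p q s * G s.isBottom s.target =
      pqInt b (k + 1) q p * (G false k + G true (k + 1)) := by
  have hsum : ∑ x ∈ antidiagonal k,
      (oddWeight b p q ⟨false, false, x.1, x.2⟩ * G false (x.1 + x.2) +
        oddWeight b p q ⟨true, false, x.1, x.2⟩ * G true (x.1 + x.2 + 1)) =
      pqInt b (k + 1) q p * (G false k + G true (k + 1)) := by
    rw [pqInt_succ_eq_sum_antidiagonal, ← Nat.sum_antidiagonal_swap, sum_mul]
    refine sum_congr rfl fun x hx => ?_
    rw [HasAntidiagonal.mem_antidiagonal] at hx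
    simp only [Prod.fst_swap, Prod.snd_swap, oddWeight, add_comm x.2, hx, Bool.false_eq_true,
      if_false]
    ring
  cases k with
  | zero => simpa [sum_stepsFrom_zero, Step.target] using hsum
  | succ k =>
    rw [sum_stepsFrom_succ, ← hsum]
    simp [oddWeight, Step.target]

theorem sum_evenWeight_mul_zero (a p q t : R) (G : Bool → ℕ → R) :
    ∑ s ∈ stepsFrom 0, evenWeight a p q t s * G s.isTop s.target =
      pqInt a 1 p q * G false 0 := by
  simp [sum_stepsFrom_zero, evenWeight, Step.target, pqInt]

theorem sum_evenWeight_mul_succ (a p q t : R) (k : ℕ) (G : Bool → ℕ → R) :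
    ∑ s ∈ stepsFrom (k + 1), evenWeight a p q t s * G s.isTop s.target =
      pqInt a (k + 2) p q * G false (k + 1) + t * pqInt a (k + 1) p q * G true k := by
  rw [sum_stepsFrom_succ, pqInt_succ_eq_sum_antidiagonal, pqInt_succ_eq_sum_antidiagonal, sum_mul,
    mul_sum, sum_mul]
  congr 1 <;> refine sum_congr rfl fun x hx => ?_ <;>
    simp only [evenWeight, Step.target, mem_antidiagonal.1 hx, Bool.false_eq_true, if_true,
      if_false, Bool.toNat_false, add_zero, zero_mul]
  · ring
  · ring

end Weights

section Paths

variable {R : Type*} [CommRing R]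

/-- The weighted number of Motzkin paths with `n` steps from height `k` to height `0`. At height
`k`, a level step has weight `β k`, an up step `U k`, and a down step to height `k` has weight
`D k`. -/
def pathSum (β U D : ℕ → R) : ℕ → ℕ → R
  | 0, k => if k = 0 then 1 else 0
  | n + 1, 0 => β 0 * pathSum β U D n 0 + U 0 * pathSum β U D n 1
  | n + 1, k + 1 => β (k + 1) * pathSum β U D n (k + 1) + U (k + 1) * pathSum β U D n (k + 2) +
      D k * pathSum β U D n k

/-- The generating series of the paths from height `k` to height `0`. -/
noncomputable def pathSeries (β U D : ℕ → R) (k : ℕ) : R⟦X⟧ :=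
  PowerSeries.mk fun n => pathSum β U D n k

/-- The part of `pathSeries` of the paths that are empty or start with a down step. -/
noncomputable def pathSource (β U D : ℕ → R) : ℕ → R⟦X⟧
  | 0 => 1
  | k + 1 => C (D k) * X * pathSeries β U D k

theorem pathSeries_eq (β U D : ℕ → R) (k : ℕ) :
    pathSeries β U D k = pathSource β U D k + C (β k) * X * pathSeries β U D k +
      C (U k) * X * pathSeries β U D (k + 1) := by
  ext n
  cases n with
  | zero => cases k <;> simp [pathSeries, pathSource, pathSum, mul_assoc]
  | succ n =>
    cases k with
    | zero => simp [pathSeries, pathSource, pathSum, mul_assoc, coeff_succ_X_mul, coeff_one]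
    | succ k =>
      simp only [pathSeries, pathSource, pathSum, mul_assoc, map_add, coeff_mk, coeff_C_mul,
        coeff_succ_X_mul]
      ring

theorem X_pow_dvd_pathSeries_sub {β lam U D : ℕ → R} (hlam : ∀ k, lam (k + 1) = U k * D k)
    (h k : ℕ) :
    X ^ h ∣ pathSeries β U D k - jConvergent β lam h k * pathSource β U D k := by
  induction h generalizing k with
  | zero => simp
  | succ h ih =>
    have hs := jConvergent_spec β lam h k
    have he := pathSeries_eq β U D k
    have hc : C (lam (k + 1)) = C (U k) * C (D k) := by rw [hlam, map_mul]
    have hr : pathSource β U D (k + 1) = C (D k) * X * pathSeries β U D k := rfl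
    have key : pathSeries β U D k - jConvergent β lam (h + 1) k * pathSource β U D k =
        X * ((pathSeries β U D (k + 1) - jConvergent β lam h (k + 1) * pathSource β U D (k + 1)) *
          (jConvergent β lam (h + 1) k * C (U k))) := by
      rw [hr]
      rw [hc] at hs
      linear_combination jConvergent β lam (h + 1) k * he - pathSeries β U D k * hs
    rw [key, pow_succ']
    exact mul_dvd_mul_left _ ((ih (k + 1)).mul_right _)

theorem hasJFraction_pathSeries {β lam U D : ℕ → R} (hlam : ∀ k, lam (k + 1) = U k * D k) :
    HasJFraction (pathSeries β U D 0) β lam := by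
  intro n
  filter_upwards [Filter.eventually_gt_atTop n] with h hn
  have := X_pow_dvd_iff.mp (X_pow_dvd_pathSeries_sub (β := β) hlam h 0) n hn
  rw [pathSource, mul_one, map_sub, sub_eq_zero] at this
  exact this.symm

/-- The value at `(z, t)` of the homogenization of a polynomial in degree `N`, where the variable
has degree `2`. It is meaningful only for polynomials of degree at most `N / 2`, the exponent
`N - 2 * j` being truncated. -/
noncomputable def homogEval (z t : R) (N : ℕ) : Polynomial R →ₗ[R] R :=
  Polynomial.lsum fun j => (t ^ j * z ^ (N - 2 * j)) • LinearMap.id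

theorem homogEval_eq_sum_range (z t : R) {N d : ℕ} {P : Polynomial R} (hP : P.natDegree ≤ d) :
    homogEval z t N P = ∑ j ∈ range (d + 1), P.coeff j * t ^ j * z ^ (N - 2 * j) := by
  rw [homogEval, Polynomial.lsum_apply, Polynomial.sum_over_range' _ (by simp) (d + 1) (by omega)]
  exact sum_congr rfl fun j _ => by
    simp only [LinearMap.smul_apply, LinearMap.id_coe, id_eq, smul_eq_mul]
    ring

theorem homogEval_succ (z t : R) {N : ℕ} {P : Polynomial R} (hP : P.natDegree ≤ N / 2) :
    homogEval z t (N + 1) P = z * homogEval z t N P := by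
  rw [homogEval_eq_sum_range z t hP, homogEval_eq_sum_range z t hP, mul_sum]
  refine sum_congr rfl fun j hj => ?_
  rw [mem_range] at hj
  rw [show N + 1 - 2 * j = N - 2 * j + 1 by omega]
  ring

theorem homogEval_X_mul (z t : R) (N : ℕ) (P : Polynomial R) :
    homogEval z t (N + 2) (Polynomial.X * P) = t * homogEval z t N P := by
  induction P using Polynomial.induction_on' with
  | add P Q hP hQ => rw [mul_add, map_add, hP, hQ, map_add, mul_add]
  | monomial j c =>
    rw [Polynomial.X_mul_monomial]
    simp only [homogEval, Polynomial.lsum_apply, LinearMap.smul_apply, LinearMap.id_coe, id_eq,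
      smul_eq_mul, mul_zero, Polynomial.sum_monomial_index,
      show N + 2 - 2 * (j + 1) = N - 2 * j by omega]
    ring

theorem homogEval_C_mul (z t : R) (N : ℕ) (c : R) (P : Polynomial R) :
    homogEval z t N (Polynomial.C c * P) = c * homogEval z t N P := by
  rw [← Polynomial.smul_eq_C_mul, map_smul, smul_eq_mul]

/-- The polynomial in which the coefficient of `X ^ j` counts the paths with `j` down steps among
those counted by `pathSum`. -/
noncomputable def pathPoly (β U D : ℕ → R) : ℕ → ℕ → Polynomial R :=
  pathSum (fun i => Polynomial.C (β i)) (fun i => Polynomial.C (U i))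
    (fun i => Polynomial.X * Polynomial.C (D i))

theorem natDegree_pathPoly_le (β U D : ℕ → R) (n k : ℕ) :
    (pathPoly β U D n k).natDegree ≤ (n + k) / 2 := by
  rw [pathPoly]
  induction n generalizing k with
  | zero => by_cases hk : k = 0 <;> simp [pathSum, hk]
  | succ n ih =>
    have hC (c : R) (k' : ℕ) (h : (n + k') / 2 ≤ (n + 1 + k) / 2) :=
      (Polynomial.natDegree_C_mul_le c _).trans ((ih k').trans h)
    cases k with
    | zero => exact Polynomial.natDegree_add_le_of_degree_le (hC _ _ (by omega)) (hC _ _ (by omega))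
    | succ k =>
      refine Polynomial.natDegree_add_le_of_degree_le
        (Polynomial.natDegree_add_le_of_degree_le (hC _ _ (by omega)) (hC _ _ (by omega))) ?_
      rw [mul_assoc, show (n + 1 + (k + 1)) / 2 = 1 + (n + k) / 2 by omega]
      exact Polynomial.natDegree_mul_le_of_le Polynomial.natDegree_X_le
        ((Polynomial.natDegree_C_mul_le _ _).trans (ih k))

theorem pathSum_eq_homogEval (β U D : ℕ → R) (z t : R) (n k : ℕ) :
    pathSum (fun i => z * β i) U (fun i => t * D i) n k =
      homogEval z t (n + k) (pathPoly β U D n k) := by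
  induction n generalizing k with
  | zero => by_cases hk : k = 0 <;>
      simp [pathSum, pathPoly, hk, homogEval, ← Polynomial.C_1, -map_one]
  | succ n ih =>
    have hlevel (k N : ℕ) (hN : n + k = N) : homogEval z t (N + 1) (pathPoly β U D n k) =
        z * homogEval z t N (pathPoly β U D n k) :=
      homogEval_succ z t (hN ▸ natDegree_pathPoly_le β U D n k)
    cases k with
    | zero =>
      have hpoly : pathPoly β U D (n + 1) 0 =
          Polynomial.C (β 0) * pathPoly β U D n 0 + Polynomial.C (U 0) * pathPoly β U D n 1 := rfl
      rw [pathSum, ih, ih, hpoly, map_add, homogEval_C_mul, homogEval_C_mul, add_zero, add_zero,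
        hlevel 0 n (add_zero n)]
      ring
    | succ k =>
      have hpoly : pathPoly β U D (n + 1) (k + 1) =
          Polynomial.C (β (k + 1)) * pathPoly β U D n (k + 1) +
          Polynomial.C (U (k + 1)) * pathPoly β U D n (k + 2) +
          Polynomial.X * Polynomial.C (D k) * pathPoly β U D n k := rfl
      rw [pathSum, ih, ih, ih, hpoly, map_add, map_add, homogEval_C_mul, homogEval_C_mul,
        mul_assoc Polynomial.X, show n + 1 + (k + 1) = n + k + 2 by omega, homogEval_X_mul,
        homogEval_C_mul, hlevel (k + 1) (n + k + 1) (add_assoc n k 1).symm, ← add_assoc n k 1,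
        ← add_assoc n k 2]
      ring

end Paths

section Expansions

variable {R : Type*} [CommRing R]

/-- The weight, apart from the factor `1 + t * y`, of a level step at height `h` of the Motzkin
paths to which the histories of the even-odd descent permutations reduce. -/
def levelCoeff (a b p q : R) (h : ℕ) : R := pqInt a (h + 1) p q * pqInt b (h + 1) q p

/-- The weight of an up step from height `h` of the Motzkin paths to which the histories of the
even-odd descent permutations reduce. -/
def riseCoeff (a b p q : R) (h : ℕ) : R := pqInt a (h + 2) p q * pqInt b (h + 1) q p

/-- The weight, apart from the factor `t`, of a down step to height `h` of the Motzkin paths to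
which the histories of the even-odd descent permutations reduce. -/
def fallCoeff (a b p q : R) (h : ℕ) : R := pqInt a (h + 1) p q * pqInt b (h + 2) q p

theorem sum_evenWeight_mul_ite_zero (a p q y t : R) (P : ℕ → R) (bottom : Bool) :
    ∑ s ∈ stepsFrom 0, evenWeight a p q t s *
        ((if bottom ∧ s.isTop then y else 1) * P s.target) = pqInt a 1 p q * P 0 := by
  rw [sum_evenWeight_mul_zero a p q t fun top h => (if bottom ∧ top then y else 1) * P h]
  simp

theorem sum_evenWeight_mul_ite_succ (a p q y t : R) (P : ℕ → R) (k : ℕ) (bottom : Bool) :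
    ∑ s ∈ stepsFrom (k + 1), evenWeight a p q t s *
        ((if bottom ∧ s.isTop then y else 1) * P s.target) =
      pqInt a (k + 2) p q * P (k + 1) +
        t * pqInt a (k + 1) p q * ((if bottom then y else 1) * P k) := by
  rw [sum_evenWeight_mul_succ a p q t k fun top h => (if bottom ∧ top then y else 1) * P h]
  simp

theorem sum_historyWeight (a b p q y t : R) (n k : ℕ) :
    ∑ H ∈ histories (2 * n) k, historyWeight a b p q y t H =
      pathSum (fun h => (1 + t * y) * levelCoeff a b p q h) (riseCoeff a b p q)
        (fun h => t * fallCoeff a b p q h) n k := by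
  induction n generalizing k with
  | zero => by_cases hk : k = 0 <;> simp [histories, historyWeight, pathSum, hk]
  | succ n ih =>
    have hsplit : ∑ H ∈ histories (2 * (n + 1)) k, historyWeight a b p q y t H =
        ∑ s₁ ∈ stepsFrom k, oddWeight b p q s₁ * ∑ s₂ ∈ stepsFrom s₁.target,
          evenWeight a p q t s₂ * ((if s₁.isBottom ∧ s₂.isTop then y else 1) *
            ∑ H ∈ histories (2 * n) s₂.target, historyWeight a b p q y t H) := by
      simp only [Nat.mul_succ, sum_histories_succ, historyWeight, ← mul_sum, mul_assoc]
    simp only [ih] at hsplit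
    rw [hsplit, sum_oddWeight_mul b p q k fun bottom h => ∑ s ∈ stepsFrom h,
      evenWeight a p q t s * ((if bottom ∧ s.isTop then y else 1) * pathSum _ _ _ n s.target)]
    cases k with
    | zero =>
      rw [sum_evenWeight_mul_ite_zero, sum_evenWeight_mul_ite_succ, pathSum, levelCoeff, riseCoeff,
        if_pos rfl]
      ring
    | succ k =>
      rw [sum_evenWeight_mul_ite_succ, sum_evenWeight_mul_ite_succ, pathSum, levelCoeff, riseCoeff,
        fallCoeff, if_pos rfl, if_neg Bool.false_ne_true]
      ring

theorem genPoly_eq_pathSum (a b p q y t : R) (n : ℕ) :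
    genPoly n a 1 b 1 p q y t =
      pathSum (fun h => (1 + t * y) * levelCoeff a b p q h) (riseCoeff a b p q)
        (fun h => t * fallCoeff a b p q h) n 0 := by
  rw [genPoly_eq_sum_histories, sum_historyWeight]

theorem hasJFraction_genPoly (a b p q y t : R) :
    HasJFraction (PowerSeries.mk fun n => genPoly n a 1 b 1 p q y t)
      (fun n => (1 + t * y) * pqInt a (n + 1) p q * pqInt b (n + 1) q p)
      (fun n => t * pqInt a n p q * pqInt a (n + 1) p q * pqInt b n q p * pqInt b (n + 1) q p) := by
  simp only [genPoly_eq_pathSum, mul_assoc (1 + t * y)]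
  exact hasJFraction_pathSeries fun k => by simp only [riseCoeff, fallCoeff]; ring

theorem dom_eq_zero_iff {n : ℕ} (σ : Equiv.Perm (Fin (2 * n))) : dom σ = 0 ↔
    ∀ j ∈ Icc 1 n, ¬ (IsDescentBottom σ (2 * j - 1) ∧ IsDescentTop σ (2 * j)) := by
  rw [dom, card_eq_zero, filter_eq_empty_iff]
  exact forall₂_congr fun j _ => not_congr and_comm

theorem genPoly_zero_X_eq_sum_ePerms (a b p q : R) (n : ℕ) :
    genPoly n (Polynomial.C a) 1 (Polynomial.C b) 1 (Polynomial.C p) (Polynomial.C q) 0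
        Polynomial.X =
      ∑ σ ∈ ePerms n, Polynomial.C (a ^ lema σ * b ^ romi σ * p ^ res σ * q ^ les σ) *
        Polynomial.X ^ des σ := by
  rw [genPoly, ePerms, sum_filter]
  refine sum_congr rfl fun σ _ => ?_
  simp only [← dom_eq_zero_iff, zero_pow_eq, map_mul, map_pow, one_pow, mul_one]
  split_ifs <;> simp

theorem pathPoly_eq_genPoly (a b p q : R) (n : ℕ) :
    pathPoly (levelCoeff a b p q) (riseCoeff a b p q) (fallCoeff a b p q) n 0 =
      genPoly n (Polynomial.C a) 1 (Polynomial.C b) 1 (Polynomial.C p) (Polynomial.C q) 0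
        Polynomial.X := by
  rw [genPoly_eq_pathSum, pathPoly]
  congr <;> funext h <;> simp [levelCoeff, riseCoeff, fallCoeff, pqInt]

theorem coeff_pathPoly_eq_gammaCoeff (a b p q : R) (n k : ℕ) :
    (pathPoly (levelCoeff a b p q) (riseCoeff a b p q) (fallCoeff a b p q) n 0).coeff k =
      gammaCoeff n k a b p q := by
  simp only [pathPoly_eq_genPoly, genPoly_zero_X_eq_sum_ePerms, Polynomial.finsetSum_coeff,
    Polynomial.coeff_C_mul_X_pow, ← sum_filter, gammaCoeff, eq_comm]

theorem genPoly_eq_sum_gammaCoeff (a b p q y t : R) (n : ℕ) :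
    genPoly n a 1 b 1 p q y t =
      ∑ k ∈ range (n / 2 + 1), gammaCoeff n k a b p q * t ^ k * (1 + t * y) ^ (n - 2 * k) := by
  simp only [genPoly_eq_pathSum, pathSum_eq_homogEval, ← coeff_pathPoly_eq_gammaCoeff]
  exact homogEval_eq_sum_range _ _ (natDegree_pathPoly_le _ _ _ n 0)

end Expansions

end EvenOdd

theorem mainTheorem4 {R : Type*} [CommRing R] (a b p q y t : R) :
    EvenOdd.HasJFraction
      (PowerSeries.mk fun n : ℕ => if n = 0 then 1 else EvenOdd.genPoly n a 1 b 1 p q y t)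
      (fun n => (1 + t * y) * EvenOdd.pqInt a (n + 1) p q * EvenOdd.pqInt b (n + 1) q p)
      (fun n => t * EvenOdd.pqInt a n p q * EvenOdd.pqInt a (n + 1) p q *
        EvenOdd.pqInt b n q p * EvenOdd.pqInt b (n + 1) q p) ∧
    ∀ n : ℕ, EvenOdd.genPoly n a 1 b 1 p q y t =
      ∑ k ∈ Finset.range (n / 2 + 1),
        EvenOdd.gammaCoeff n k a b p q * t ^ k * (1 + y * t) ^ (n - 2 * k) := by
  have hzero : EvenOdd.genPoly 0 a 1 b 1 p q y t = 1 := by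
    rw [EvenOdd.genPoly_eq_pathSum, EvenOdd.pathSum, if_pos rfl]
  have hseries (n : ℕ) : (if n = 0 then 1 else EvenOdd.genPoly n a 1 b 1 p q y t) =
      EvenOdd.genPoly n a 1 b 1 p q y t := by
    split_ifs with hn
    · rw [hn, hzero]
    · rfl
  simp only [hseries, mul_comm y t]
  exact ⟨EvenOdd.hasJFraction_genPoly a b p q y t, EvenOdd.genPoly_eq_sum_gammaCoeff a b p q y t⟩
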